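/- Let $G=(V,E)$ be a (not necessarily finite) simple connected undirected graph with distance function $d$, and for vertices $v,w$ let $I(v,w)=\{u : d(v,u)+d(u,w)=d(v,w)\}$. A *profile* is a finite sequence $\pi=(x_1,\dots,x_n)$ of vertices, $\pi^2$ is the concatenation of $\pi$ with itself, and $F_\pi(v)=\sum_{i} d(v,x_i)$. A *pairing* $P$ of a profile of even length is a partition of its terms into disjoint unordered pairs; the two members of a pair may be the same vertex if that vertex occurs repeatedly in the profile. Put $D(P)=\sum_{\{a,b\}\in P} d(a,b)$. The pairing $P$ of $\pi$ is *perfect* if $D(P)=F_\pi(v)$ for some vertex $v$. The graph $G$ has the *double-pairing property* if for every profile $\pi$ the profile $\pi^2$ has a perfect pairing. A *weight function* is a finitely supported function $b:V\to\mathbb{R}_{\ge 0}$ (if $V$ is finite, this is any function $b:V\to\mathbb{R}_{\ge 0}$). Put $F_b(v)=\sum_{z\in V} b(z)\,d(v,z)$ and let $\mathrm{Med}(b)$ be the set of vertices minimizing $F_b$. For a vertex $u$, the auxiliary graph $A_u=(V,E_u)$ has as edges all unordered pairs $vw$ (with $v=w$ allowed) such that $u\in I(v,w)$; thus $A_u$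 has exactly one loop, at $u$. A *fractional perfect $b$-matching* of $A_u$ is a function $x:E_u\to\mathbb{R}_{\ge 0}$ with $\sum_{e\in E_u:\, v\in e} x(e)=b(v)$ for all $v\in V$. Let $\mathrm{Ma}(u)$ be the set of weight functions $b$ such that $A_u$ has a fractional perfect $b$-matching, and let $\mathrm{Me}(u)$ be the set of weight functions $b$ with $u\in\mathrm{Med}(b)$. **Proposition.** $G$ has the double-pairing property if and only if $\mathrm{Ma}(u)=\mathrm{Me}(u)$ for every vertex $u\in V$. -/

import Mathlib

open scoped NNReal

noncomputable section

namespace SimpleGraph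

variable {V : Type*} (G : SimpleGraph V)

/-- The interval `I(v, w)`: the vertices on shortest paths between `v` and `w`. -/
def interval (v w : V) : Set V :=
  {u | G.dist v u + G.dist u w = G.dist v w}

/-- The distance between the two members of an unordered pair (which may be a pair `{a, a}`). -/
def pairDist : Sym2 V → ℕ :=
  Sym2.lift ⟨fun a b => G.dist a b, fun _ _ => G.dist_comm⟩

/-- `F_π(v)`: the total distance from `v` to the profile `π` (a finite sequence of vertices). -/
def totalDist (π : List V) (v : V) : ℕ :=
  (π.map fun x => G.dist v x).sum

/-- A pairing of a profile: a partition of its terms into unordered pairs, recorded as a multiset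
of unordered pairs whose members are, with multiplicity, exactly the terms of `π`. -/
def IsPairing (π : List V) (P : Multiset (Sym2 V)) : Prop :=
  (P.map fun e => e.toMultiset).sum = (π : Multiset V)

/-- `D(P)`: the sum of the distances `d(a, b)` over the pairs `{a, b}` of `P`. -/
def pairingDist (P : Multiset (Sym2 V)) : ℕ :=
  (P.map G.pairDist).sum

/-- The profile `π` has a perfect pairing. -/
def HasPerfectPairing (π : List V) : Prop :=
  ∃ P : Multiset (Sym2 V), IsPairing π P ∧ ∃ v : V, G.pairingDist P = G.totalDist π v

/-- For every profile `π`, the double profile `π²` has a perfect pairing. -/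
def DoublePairingProperty : Prop :=
  ∀ π : List V, G.HasPerfectPairing (π ++ π)

/-- `F_b(v) = ∑ z, b(z) d(v, z)` for a weight function `b`. Weight functions are nonnegative and
have finite support (which is no restriction when `V` is finite). -/
def weightedDist (b : V →₀ ℝ≥0) (v : V) : ℝ≥0 :=
  b.sum fun z t => t * (G.dist v z : ℝ≥0)

/-- `Med(b)`: the vertices minimizing `F_b`. -/
def weightedMedian (b : V →₀ ℝ≥0) : Set V :=
  {v | ∀ w : V, G.weightedDist b v ≤ G.weightedDist b w}

/-- The edge set `E_u` of the auxiliary graph `A_u`: all unordered pairs `{v, w}` with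
`u ∈ I(v, w)`. The only pair `{v, v}` among them is the loop `{u, u}`. -/
def auxEdges (u : V) : Set (Sym2 V) :=
  {e | ∃ v w : V, e = s(v, w) ∧ u ∈ G.interval v w}

open Classical in
/-- `x` is a fractional perfect `b`-matching of `A_u`: a nonnegative weight function on `E_u`
(extended by zero) such that the weights of the edges containing `v` sum to `b v`, for each `v`.
A finitely supported `b` forces `x` to have finite support. -/
def IsFractionalPerfectMatching (u : V) (b : V →₀ ℝ≥0) (x : Sym2 V →₀ ℝ≥0) : Prop :=
  (x.support : Set (Sym2 V)) ⊆ G.auxEdges u ∧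
    ∀ v : V, ∑ e ∈ x.support with v ∈ e, x e = b v

/-- `Ma(u)`: the weight functions `b` for which `A_u` has a fractional perfect `b`-matching. -/
def Ma (u : V) : Set (V →₀ ℝ≥0) :=
  {b | ∃ x : Sym2 V →₀ ℝ≥0, G.IsFractionalPerfectMatching u b x}

/-- `Me(u)`: the weight functions `b` with `u ∈ Med(b)`. -/
def Me (u : V) : Set (V →₀ ℝ≥0) :=
  {b | u ∈ G.weightedMedian b}

end SimpleGraph

end

open scoped NNReal

noncomputable section

namespace SimpleGraph

variable {V : Type*} (G : SimpleGraph V)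

/-! By the triangle inequality a pair {v, w} satisfies d(v, w) ≤ d(u, v) + d(u, w), with equality
exactly when it is an edge of A_u. Hence Ma(u) ⊆ Me(u) always, and D(P) ≤ F_π(u) for every pairing P
of π, with equality iff all pairs of P are edges of A_u.

If Me(u) ⊆ Ma(u), take u to be a median of π. A fractional matching for the multiplicities of π
becomes a doubly stochastic matrix on the positions of π, and Birkhoff's theorem yields a
permutation σ whose pairs {x_i, x_σ(i)} form a perfect pairing of π² (`exists_perm_of_mem_Ma`).

Conversely, a perfect pairing of π² is twice a fractional matching, which settles integral weights
and, by scaling, rational ones. A real b has values that are rational linear forms in reals r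
independent over ℚ. The median inequalities at u survive small perturbations of r
(`eventually_sum_dist_le`), and r is a convex combination of nearby rational points
(`exists_rational_box`), so b lies in the convex cone Ma(u). -/

/-- `weightedDist` as a linear functional of the weight function. -/
def weightedDistLinear (u : V) : (V →₀ ℝ≥0) →ₗ[ℝ≥0] ℝ≥0 :=
  Finsupp.linearCombination ℝ≥0 fun z => (G.dist u z : ℝ≥0)

lemma weightedDistLinear_apply (u : V) (b : V →₀ ℝ≥0) :
    G.weightedDistLinear u b = G.weightedDist b u := rfl

lemma weightedDistLinear_single (u v : V) (t : ℝ≥0) :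
    G.weightedDistLinear u (Finsupp.single v t) = t * G.dist u v := by
  simp [weightedDistLinear]

lemma coe_weightedDist_eq_sum (b : V →₀ ℝ≥0) (u : V) {s : Finset V} (hs : b.support ⊆ s) :
    (G.weightedDist b u : ℝ) = ∑ z ∈ s, (b z : ℝ) * G.dist u z := by
  rw [weightedDist, Finsupp.sum_of_support_subset b hs _ (by simp)]
  simp

/-! ### Multiplicity weights and the cone Ma(u) -/

/-- The weight function counting the multiplicities in a multiset of vertices. -/
def multisetWeight : Multiset V →+ (V →₀ ℝ≥0) :=
  Multiset.sumAddMonoidHom.comp (Multiset.mapAddMonoidHom fun v => Finsupp.single v 1)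

lemma multisetWeight_apply (s : Multiset V) :
    multisetWeight s = (s.map fun v => Finsupp.single v (1 : ℝ≥0)).sum := rfl

@[simp] lemma multisetWeight_singleton (v : V) :
    multisetWeight {v} = Finsupp.single v (1 : ℝ≥0) := by
  simp [multisetWeight_apply]

lemma multisetWeight_eq_count [DecidableEq V] (s : Multiset V) (v : V) :
    multisetWeight s v = s.count v := by
  induction s using Multiset.induction_on with
  | empty => simp
  | cons a s ih =>
    rw [← Multiset.singleton_add, map_add, multisetWeight_singleton, Finsupp.add_apply, ih,
      Multiset.count_add, Multiset.count_singleton, Finsupp.single_apply]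
    by_cases h : a = v
    · simp [h]
    · simp [h, Ne.symm h]

lemma weightedDist_multisetWeight (π : List V) (u : V) :
    G.weightedDist (multisetWeight (π : Multiset V)) u = G.totalDist π u := by
  rw [← weightedDistLinear_apply]
  induction π with
  | nil => simp [totalDist]
  | cons a l ih =>
    rw [← Multiset.cons_coe, ← Multiset.singleton_add, map_add, map_add, ih]
    simp [weightedDistLinear_single, totalDist]

open Classical in
/-- The linear operator sending edge weights to the total weights at the vertices. -/
def vertexWeight : (Sym2 V →₀ ℝ≥0) →ₗ[ℝ≥0] (V →₀ ℝ≥0) :=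
  Finsupp.linearCombination ℝ≥0 fun e : Sym2 V => ∑ v ∈ e.toFinset, Finsupp.single v 1

open Classical in
lemma vertexWeight_apply (x : Sym2 V →₀ ℝ≥0) (v : V) :
    vertexWeight x v = ∑ e ∈ x.support with v ∈ e, x e := by
  rw [vertexWeight, Finsupp.linearCombination_apply, Finsupp.sum, Finsupp.finsetSum_apply,
    Finset.sum_filter]
  refine Finset.sum_congr rfl fun e _ => ?_
  simp [Finsupp.single_apply]

lemma vertexWeight_single_mk {v w : V} (h : v ≠ w) (t : ℝ≥0) :
    vertexWeight (Finsupp.single s(v, w) t) = Finsupp.single v t + Finsupp.single w t := by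
  classical
  have : s(v, w).toFinset = {v, w} := by ext; simp
  rw [vertexWeight, Finsupp.linearCombination_single, this, Finset.sum_pair h]
  simp

lemma vertexWeight_single_diag (v : V) (t : ℝ≥0) :
    vertexWeight (Finsupp.single s(v, v) t) = Finsupp.single v t := by
  classical
  have : s(v, v).toFinset = {v} := by ext; simp
  rw [vertexWeight, Finsupp.linearCombination_single, this]
  simp

lemma isFractionalPerfectMatching_iff (u : V) (b : V →₀ ℝ≥0) (x : Sym2 V →₀ ℝ≥0) :
    G.IsFractionalPerfectMatching u b x ↔
      x ∈ Finsupp.supported ℝ≥0 ℝ≥0 (G.auxEdges u) ∧ vertexWeight x = b := by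
  simp only [IsFractionalPerfectMatching, Finsupp.mem_supported, DFunLike.ext_iff,
    vertexWeight_apply]

/-- `Ma(u)` as a submodule. -/
def maSubmodule (u : V) : Submodule ℝ≥0 (V →₀ ℝ≥0) :=
  (Finsupp.supported ℝ≥0 ℝ≥0 (G.auxEdges u)).map vertexWeight

lemma mem_maSubmodule (u : V) (b : V →₀ ℝ≥0) : b ∈ G.maSubmodule u ↔ b ∈ G.Ma u := by
  simp [maSubmodule, Ma, isFractionalPerfectMatching_iff]

lemma multisetWeight_toMultiset_mk (v w : V) :
    multisetWeight s(v, w).toMultiset = Finsupp.single v (1 : ℝ≥0) + Finsupp.single w 1 := by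
  have : s(v, w).toMultiset = {v} + {w} := rfl
  rw [this, map_add, multisetWeight_singleton, multisetWeight_singleton]

variable {G} in
/-- The weight function of an edge, counting a loop twice, lies in `Ma(u)`. -/
lemma multisetWeight_toMultiset_mem {u : V} {e : Sym2 V} (he : e ∈ G.auxEdges u) :
    multisetWeight e.toMultiset ∈ G.maSubmodule u := by
  induction e with | _ v w
  rw [multisetWeight_toMultiset_mk]
  by_cases h : v = w
  · subst h
    refine ⟨Finsupp.single s(v, v) 2, Finsupp.single_mem_supported _ _ he, ?_⟩
    rw [vertexWeight_single_diag, ← Finsupp.single_add, one_add_one_eq_two]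
  · exact ⟨Finsupp.single s(v, w) 1, Finsupp.single_mem_supported _ _ he,
      vertexWeight_single_mk h 1⟩

/-- Generators of the uniform shape δ_v + δ_w, loops included, spare later inductions a case split
on loops. -/
lemma maSubmodule_le_span (u : V) :
    G.maSubmodule u ≤
      Submodule.span ℝ≥0 ((fun e : Sym2 V => multisetWeight e.toMultiset) '' G.auxEdges u) := by
  rw [maSubmodule, Finsupp.supported_eq_span_single, Submodule.map_span, Submodule.span_le]
  rintro _ ⟨_, ⟨e, he, rfl⟩, rfl⟩
  have hmem := Submodule.subset_span (R := ℝ≥0)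
    (Set.mem_image_of_mem (fun e : Sym2 V => multisetWeight e.toMultiset) he)
  induction e with | _ v w
  rw [multisetWeight_toMultiset_mk] at hmem
  by_cases h : v = w
  · subst h
    -- A loop counts once in a matching but twice as a pair, hence the factor 1/2.
    have := Submodule.smul_mem _ (2⁻¹ : ℝ≥0) hmem
    rw [← Finsupp.single_add, Finsupp.smul_single, one_add_one_eq_two, smul_eq_mul,
      inv_mul_cancel₀ two_ne_zero] at this
    rwa [SetLike.mem_coe, vertexWeight_single_diag]
  · rwa [SetLike.mem_coe, vertexWeight_single_mk h]

lemma mk_mem_auxEdges {u v w : V} : s(v, w) ∈ G.auxEdges u ↔ u ∈ G.interval v w := by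
  refine ⟨?_, fun h => ⟨v, w, rfl, h⟩⟩
  rintro ⟨a, b, h, hu⟩
  rcases Sym2.eq_iff.1 h with ⟨rfl, rfl⟩ | ⟨rfl, rfl⟩
  · exact hu
  · have h1 : G.dist w u + G.dist u v = G.dist w v := hu
    change G.dist v u + G.dist u w = G.dist v w
    rw [G.dist_comm (u := v) (v := u), G.dist_comm (u := u) (v := w),
      G.dist_comm (u := v) (v := w)]
    omega

variable {G}

/-! ### Matchable weights have u as a median -/

lemma Ma_subset_Me (hG : G.Connected) (u : V) : G.Ma u ⊆ G.Me u := by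
  intro b hb w
  rw [← mem_maSubmodule] at hb
  have hspan := G.maSubmodule_le_span u hb
  clear hb
  rw [← weightedDistLinear_apply, ← weightedDistLinear_apply]
  induction hspan using Submodule.span_induction with
  | mem b hb' =>
    obtain ⟨e, he, rfl⟩ := hb'
    induction e with | _ v z
    rw [mk_mem_auxEdges] at he
    have h1 : G.dist v u + G.dist u z = G.dist v z := he
    have h2 := hG.dist_triangle (u := v) (v := w) (w := z)
    rw [G.dist_comm (u := v) (v := u)] at h1
    rw [G.dist_comm (u := v) (v := w)] at h2
    simp only [multisetWeight_toMultiset_mk, map_add, weightedDistLinear_single, one_mul]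
    exact_mod_cast h1.trans_le h2
  | zero => simp
  | add x y _ _ hx hy =>
    rw [map_add, map_add]
    exact add_le_add hx hy
  | smul a x _ hx =>
    rw [map_smul, map_smul]
    exact mul_le_mul_right hx a

/-! ### From matchings to permutations -/

/-- A weight function in `Ma(u)` is the common marginal of a transport plan supported on the
pairs `(v, w)` with `u ∈ I(v, w)`. -/
lemma exists_transport_of_mem_Ma {u : V} {b : V →₀ ℝ≥0} (hb : b ∈ G.Ma u) :
    ∃ Z : V × V →₀ ℝ≥0, (∀ v w, Z (v, w) ≠ 0 → u ∈ G.interval v w) ∧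
      Z.mapDomain Prod.fst = b ∧ Z.mapDomain Prod.snd = b := by
  classical
  rw [← mem_maSubmodule] at hb
  have hspan := G.maSubmodule_le_span u hb
  clear hb
  induction hspan using Submodule.span_induction with
  | mem b hb' =>
    obtain ⟨e, he, rfl⟩ := hb'
    induction e with | _ v z
    -- Using both orientations of the edge makes the two marginals equal.
    refine ⟨Finsupp.single (v, z) 1 + Finsupp.single (z, v) 1, fun a c h => ?_, ?_, ?_⟩
    · rw [Finsupp.add_apply, Finsupp.single_apply, Finsupp.single_apply] at h
      rw [← mk_mem_auxEdges]
      by_cases h1 : (v, z) = (a, c)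
      · cases h1; exact he
      · by_cases h2 : (z, v) = (a, c)
        · cases h2; rwa [Sym2.eq_swap]
        · simp [h1, h2] at h
    · simp [Finsupp.mapDomain_add, multisetWeight_toMultiset_mk]
    · simp [Finsupp.mapDomain_add, multisetWeight_toMultiset_mk, add_comm]
  | zero => exact ⟨0, by simp⟩
  | add x y _ _ hx hy =>
    obtain ⟨Z, h1, h2, h3⟩ := hx
    obtain ⟨Z', h1', h2', h3'⟩ := hy
    refine ⟨Z + Z', fun v w h => ?_, ?_, ?_⟩
    · by_cases hz : Z (v, w) = 0
      · exact h1' v w fun h0 => h (by simp [hz, h0])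
      · exact h1 v w hz
    · rw [Finsupp.mapDomain_add, h2, h2']
    · rw [Finsupp.mapDomain_add, h3, h3']
  | smul a x _ hx =>
    obtain ⟨Z, h1, h2, h3⟩ := hx
    refine ⟨a • Z, fun v w h => h1 v w fun h0 => h (by simp [h0]), ?_, ?_⟩
    · rw [Finsupp.mapDomain_smul, h2]
    · rw [Finsupp.mapDomain_smul, h3]

lemma _root_.Finsupp.le_mapDomain_apply {α β : Type*} (Z : α →₀ ℝ≥0) (f : α → β) (a : α) :
    Z a ≤ Z.mapDomain f (f a) := by
  classical
  by_cases ha : a ∈ Z.support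
  · rw [Finsupp.mapDomain, Finsupp.sum, Finsupp.finsetSum_apply]
    refine le_trans ?_ (Finset.single_le_sum (f := fun x => Finsupp.single (f x) (Z x) (f a))
      (fun _ _ => zero_le) ha)
    simp
  · simp [Finsupp.notMem_support_iff.1 ha]

lemma _root_.Finsupp.sum_fst_eq_mapDomain {α : Type*} (Z : α × α →₀ ℝ≥0) {s : Finset α}
    (hs : (Z.mapDomain Prod.snd).support ⊆ s) (a : α) :
    ∑ y ∈ s, Z (a, y) = Z.mapDomain Prod.fst a := by
  classical
  rw [Finsupp.mapDomain, Finsupp.sum, Finsupp.finsetSum_apply]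
  simp only [Finsupp.single_apply]
  rw [← Finset.sum_filter]
  refine Finset.sum_bij_ne_zero (fun y _ _ => (a, y)) (fun y _ h => ?_) (fun _ _ _ _ _ _ h => ?_)
    (fun p hp h => ?_) (fun _ _ _ => rfl)
  · simpa using h
  · exact (Prod.ext_iff.1 h).2
  · obtain ⟨p1, p2⟩ := p
    obtain ⟨-, rfl⟩ := Finset.mem_filter.1 hp
    refine ⟨p2, hs ?_, h, rfl⟩
    rw [Finsupp.mem_support_iff]
    exact ((pos_iff_ne_zero.2 h).trans_le (Z.le_mapDomain_apply Prod.snd (p1, p2))).ne'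

lemma _root_.Finsupp.sum_snd_eq_mapDomain {α : Type*} (Z : α × α →₀ ℝ≥0) {s : Finset α}
    (hs : (Z.mapDomain Prod.fst).support ⊆ s) (a : α) :
    ∑ y ∈ s, Z (y, a) = Z.mapDomain Prod.snd a := by
  have h1 : (Z.mapDomain Prod.swap).mapDomain Prod.fst = Z.mapDomain Prod.snd := by
    rw [← Finsupp.mapDomain_comp]; rfl
  have h2 : (Z.mapDomain Prod.swap).mapDomain Prod.snd = Z.mapDomain Prod.fst := by
    rw [← Finsupp.mapDomain_comp]; rfl
  rw [← h1, ← (Z.mapDomain Prod.swap).sum_fst_eq_mapDomain (h2 ▸ hs)]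
  exact Finset.sum_congr rfl fun y _ =>
    (Finsupp.mapDomain_apply Prod.swap_injective Z (y, a)).symm

/-- The support of a doubly stochastic matrix contains a permutation. -/
lemma _root_.Matrix.exists_perm_ne_zero_of_mem_doublyStochastic {n : Type*} [Fintype n]
    [DecidableEq n] {M : Matrix n n ℝ} (hM : M ∈ doublyStochastic ℝ n) :
    ∃ σ : Equiv.Perm n, ∀ i, M i (σ i) ≠ 0 := by
  -- Birkhoff: any permutation with positive weight in the convex combination lies in the support.
  obtain ⟨w, hw, hw1, rfl⟩ := exists_eq_sum_perm_of_mem_doublyStochastic hM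
  obtain ⟨σ, -, hσ⟩ : ∃ σ ∈ Finset.univ, w σ ≠ 0 :=
    Finset.exists_ne_zero_of_sum_ne_zero (by rw [hw1]; exact one_ne_zero)
  refine ⟨σ, fun i => ?_⟩
  rw [Matrix.sum_apply]
  refine (lt_of_lt_of_le ((hw σ).lt_of_ne' hσ) ?_).ne'
  refine le_trans ?_ (Finset.single_le_sum
    (f := fun τ : Equiv.Perm n => (w τ • τ.permMatrix ℝ) i (σ i)) (fun τ _ => ?_)
    (Finset.mem_univ σ))
  · simp [PEquiv.toMatrix_apply]
  · simp only [Matrix.smul_apply, PEquiv.toMatrix_apply, smul_eq_mul]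
    exact mul_nonneg (hw τ) (by split_ifs <;> norm_num)

lemma sum_get_eq_sum_map {M : Type*} [AddCommMonoid M] (π : List V) (f : V → M) :
    ∑ i, f (π.get i) = (π.map f).sum := by
  rw [← List.sum_ofFn]
  conv_rhs => rw [← List.ofFn_get π, List.map_ofFn]
  rfl

/-- If the multiplicities of `π` form a weight function in `Ma(u)`, then some permutation moves
each term of `π` to one that sees it across `u`. -/
lemma exists_perm_of_mem_Ma {u : V} {π : List V}
    (h : multisetWeight (π : Multiset V) ∈ G.Ma u) :
    ∃ σ : Equiv.Perm (Fin π.length), ∀ i, u ∈ G.interval (π.get i) (π.get (σ i)) := by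
  classical
  obtain ⟨Z, hZ, h1, h2⟩ := exists_transport_of_mem_Ma h
  set b := multisetWeight (π : Multiset V) with hb
  have hbc : ∀ v, b v = π.count v := fun v => by
    rw [hb, multisetWeight_eq_count, Multiset.coe_count]
  have hsupp : b.support ⊆ π.toFinset := fun v hv => by
    rw [Finsupp.mem_support_iff, hbc, Nat.cast_ne_zero] at hv
    exact List.mem_toFinset.2 (List.count_pos_iff.1 (Nat.pos_of_ne_zero hv))
  have hpos : ∀ v ∈ π, (b v : ℝ) ≠ 0 := fun v hv => by
    rw [hbc]
    exact_mod_cast (List.count_pos_iff.2 hv).ne'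
  have hsum : ∀ f : V → ℝ, ∑ j, f (π.get j) = ∑ y ∈ π.toFinset, (b y : ℝ) * f y := fun f => by
    rw [sum_get_eq_sum_map, Finset.sum_list_map_count]
    simp [hbc]
  -- A vertex v fills b(v) positions, so the mass Z(v, w) is shared equally among b(v)b(w) pairs of
  -- positions.
  let M : Matrix (Fin π.length) (Fin π.length) ℝ := fun i j =>
    (Z (π.get i, π.get j) : ℝ) / (b (π.get i) * b (π.get j))
  have hM : M ∈ doublyStochastic ℝ (Fin π.length) := by
    refine mem_doublyStochastic_iff_sum.2 ⟨fun i j => by positivity, fun i => ?_, fun j => ?_⟩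
    · have hi := hpos _ (π.get_mem i)
      rw [hsum fun y => (Z (π.get i, y) : ℝ) / (b (π.get i) * b y)]
      have hE : (∑ y ∈ π.toFinset, (Z (π.get i, y) : ℝ)) = b (π.get i) := by
        rw [← NNReal.coe_sum, Z.sum_fst_eq_mapDomain (h2 ▸ hsupp), h1]
      rw [← div_self hi]
      nth_rw 2 [← hE]
      rw [Finset.sum_div]
      refine Finset.sum_congr rfl fun y hy => ?_
      have hy := hpos y (List.mem_toFinset.1 hy)
      field_simp
    · have hj := hpos _ (π.get_mem j)
      rw [hsum fun y => (Z (y, π.get j) : ℝ) / (b y * b (π.get j))]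
      have hE : (∑ y ∈ π.toFinset, (Z (y, π.get j) : ℝ)) = b (π.get j) := by
        rw [← NNReal.coe_sum, Z.sum_snd_eq_mapDomain (h1 ▸ hsupp), h2]
      rw [← div_self hj]
      nth_rw 2 [← hE]
      rw [Finset.sum_div]
      refine Finset.sum_congr rfl fun y hy => ?_
      have hy := hpos y (List.mem_toFinset.1 hy)
      field_simp
  obtain ⟨σ, hσ⟩ := Matrix.exists_perm_ne_zero_of_mem_doublyStochastic hM
  refine ⟨σ, fun i => hZ _ _ fun h0 => hσ i ?_⟩
  simp only [M, h0, NNReal.coe_zero, zero_div]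

/-! ### Perfect pairings -/

lemma totalDist_append (π ρ : List V) (v : V) :
    G.totalDist (π ++ ρ) v = G.totalDist π v + G.totalDist ρ v := by
  simp [totalDist]

lemma totalDist_eq_sum_get (π : List V) (v : V) :
    G.totalDist π v = ∑ i, G.dist v (π.get i) :=
  (sum_get_eq_sum_map π (G.dist v)).symm

lemma coe_eq_sum_get (π : List V) : (π : Multiset V) = ∑ i, {π.get i} := by
  rw [sum_get_eq_sum_map π fun v => ({v} : Multiset V)]
  exact (Multiset.sum_map_singleton (π : Multiset V)).symm

/-- Each position occurs once as a source and once as a target of the permutation, so the pairs use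
up exactly π². -/
lemma hasPerfectPairing_of_mem_Ma {u : V} {π : List V}
    (h : multisetWeight (π : Multiset V) ∈ G.Ma u) : G.HasPerfectPairing (π ++ π) := by
  obtain ⟨σ, hσ⟩ := exists_perm_of_mem_Ma h
  refine ⟨Finset.univ.val.map fun i => s(π.get i, π.get (σ i)), ?_, u, ?_⟩
  · have hmk : ∀ v w : V, s(v, w).toMultiset = {v} + {w} := fun _ _ => rfl
    rw [IsPairing, Multiset.map_map, ← Multiset.coe_add]
    change ∑ i, s(π.get i, π.get (σ i)).toMultiset = _
    simp only [hmk, Finset.sum_add_distrib]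
    rw [Equiv.sum_comp σ fun i => ({π.get i} : Multiset V), ← coe_eq_sum_get]
  · rw [pairingDist, Multiset.map_map, totalDist_append]
    change ∑ i, G.dist (π.get i) (π.get (σ i)) = _
    have : ∀ i, G.dist (π.get i) (π.get (σ i)) =
        G.dist u (π.get i) + G.dist u (π.get (σ i)) := fun i => by
      rw [G.dist_comm (u := u) (v := π.get i)]
      exact (hσ i).symm
    simp only [this, Finset.sum_add_distrib]
    rw [Equiv.sum_comp σ fun i => G.dist u (π.get i), ← totalDist_eq_sum_get]

lemma doublePairingProperty_of_Me_subset_Ma [Nonempty V] (h : ∀ u : V, G.Me u ⊆ G.Ma u) :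
    G.DoublePairingProperty := by
  intro π
  -- Distances are natural numbers, so a median exists even when V is infinite.
  let u := Function.argmin (G.totalDist π)
  refine hasPerfectPairing_of_mem_Ma (h u fun w => ?_)
  rw [weightedDist_multisetWeight, weightedDist_multisetWeight]
  exact_mod_cast Function.argmin_le (G.totalDist π) w

lemma pairDist_le (hG : G.Connected) (u : V) (e : Sym2 V) :
    G.pairDist e ≤ (e.toMultiset.map (G.dist u)).sum := by
  induction e with | _ v w
  have hmk : s(v, w).toMultiset = {v} + {w} := rfl
  have := hG.dist_triangle (u := v) (v := u) (w := w)
  rw [G.dist_comm (u := v) (v := u)] at this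
  simpa [hmk, pairDist] using this

lemma mem_auxEdges_of_sum_le {u : V} {e : Sym2 V} (hG : G.Connected)
    (h : (e.toMultiset.map (G.dist u)).sum ≤ G.pairDist e) : e ∈ G.auxEdges u := by
  have h' := le_antisymm h (pairDist_le hG u e)
  induction e with | _ v w
  rw [mk_mem_auxEdges]
  have hmk : s(v, w).toMultiset = {v} + {w} := rfl
  change G.dist v u + G.dist u w = G.dist v w
  rw [G.dist_comm (u := v) (v := u)]
  simpa [hmk, pairDist] using h'

lemma IsPairing.totalDist_eq {π : List V} {P : Multiset (Sym2 V)} (hP : IsPairing π P) (u : V) :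
    G.totalDist π u = (P.map fun e => (e.toMultiset.map (G.dist u)).sum).sum := by
  have h : G.totalDist π u = ((π : Multiset V).map (G.dist u)).sum := by
    simp [totalDist]
  rw [h, ← hP]
  have := map_multiset_sum
    (Multiset.sumAddMonoidHom.comp (Multiset.mapAddMonoidHom (G.dist u))) (P.map Sym2.toMultiset)
  simpa [Multiset.map_map, Function.comp_def] using this

/-- If `D(P)` attains its upper bound `F_π(u)`, then every pair of `P` is an edge of `A_u`. -/
lemma IsPairing.mem_auxEdges {π : List V} {P : Multiset (Sym2 V)} (hG : G.Connected)
    (hP : IsPairing π P) {u : V} (hu : G.totalDist π u ≤ G.pairingDist P) :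
    ∀ e ∈ P, e ∈ G.auxEdges u := by
  intro e he
  refine mem_auxEdges_of_sum_le hG ?_
  by_contra hlt
  rw [hP.totalDist_eq] at hu
  exact hu.not_gt (Multiset.sum_lt_sum (fun e _ => pairDist_le hG u e) ⟨e, he, not_le.1 hlt⟩)

/-- A pairing of π² that is perfect at v has D(P) = 2F_π(v) ≥ 2F_π(u), so it reaches the upper bound
at u and uses only edges of A_u. Its edge weights sum to twice the multiplicities of π. -/
lemma multisetWeight_mem_Ma (hG : G.Connected) (h : G.DoublePairingProperty) {u : V} {π : List V}
    (hu : multisetWeight (π : Multiset V) ∈ G.Me u) :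
    multisetWeight (π : Multiset V) ∈ G.maSubmodule u := by
  obtain ⟨P, hP, v, hv⟩ := h π
  have huv := hu v
  rw [weightedDist_multisetWeight, weightedDist_multisetWeight, Nat.cast_le] at huv
  have hedge := hP.mem_auxEdges hG (u := u) (by
    rw [hv, totalDist_append, totalDist_append]; omega)
  have hsum : (P.map fun e => multisetWeight e.toMultiset).sum =
      (2 : ℝ≥0) • multisetWeight (π : Multiset V) := by
    rw [two_smul, ← map_add, Multiset.coe_add, ← hP, map_multiset_sum, Multiset.map_map]
    rfl
  have hmem : (2 : ℝ≥0) • multisetWeight (π : Multiset V) ∈ G.maSubmodule u := by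
    rw [← hsum]
    refine multiset_sum_mem _ fun b hb => ?_
    obtain ⟨e, he, rfl⟩ := Multiset.mem_map.1 hb
    exact multisetWeight_toMultiset_mem (hedge e he)
  exact (Submodule.smul_mem_iff _ two_ne_zero).1 hmem

/-! ### Rational weights -/

lemma smul_mem_Me {u : V} {b : V →₀ ℝ≥0} (hb : b ∈ G.Me u) (t : ℝ≥0) : t • b ∈ G.Me u := by
  intro w
  rw [← weightedDistLinear_apply, ← weightedDistLinear_apply, map_smul, map_smul]
  exact mul_le_mul_right (hb w) t

/-- A weight function with rational values is a multiple of a multiplicity function. -/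
lemma exists_smul_eq_multisetWeight {b : V →₀ ℝ≥0} (hb : ∀ v, ∃ q : ℚ≥0, b v = q) :
    ∃ t : ℝ≥0, t ≠ 0 ∧ ∃ π : List V, t • b = multisetWeight (π : Multiset V) := by
  classical
  choose q hq using hb
  let N : ℕ := ∏ v ∈ b.support, (q v).den
  have hN : ∀ v, ∃ n : ℕ, (N : ℝ≥0) * b v = n := fun v => by
    by_cases hv : v ∈ b.support
    · obtain ⟨m, hm⟩ := Finset.dvd_prod_of_mem (fun v => (q v).den) hv
      refine ⟨m * (q v).num, ?_⟩
      have h1 : (q v).den * q v = (q v).num := NNRat.den_mul_eq_num _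
      have h2 : N = (q v).den * m := hm
      have h3 : (N : ℚ≥0) * q v = (m * (q v).num : ℕ) := by
        rw [h2, Nat.cast_mul, Nat.cast_mul, ← h1]; ring
      rw [hq v]
      exact_mod_cast congrArg (NNRat.cast : ℚ≥0 → ℝ≥0) h3
    · exact ⟨0, by simp [Finsupp.notMem_support_iff.1 hv]⟩
  choose n hn using hN
  refine ⟨N, Nat.cast_ne_zero.2 (Finset.prod_ne_zero_iff.2 fun v _ => (q v).den_ne_zero),
    (Finsupp.toMultiset (Finsupp.onFinset b.support n fun v hv => ?_)).toList, ?_⟩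
  · rw [Finsupp.mem_support_iff]
    intro h0
    have := hn v
    rw [h0, mul_zero] at this
    exact hv (by exact_mod_cast this.symm)
  · ext v
    rw [Multiset.coe_toList, multisetWeight_eq_count, Finsupp.count_toMultiset]
    simp [hn]

lemma mem_maSubmodule_of_rational (hG : G.Connected) (h : G.DoublePairingProperty) {u : V}
    {b : V →₀ ℝ≥0} (hb : ∀ v, ∃ q : ℚ≥0, b v = q) (hu : b ∈ G.Me u) : b ∈ G.maSubmodule u := by
  obtain ⟨t, ht, π, hπ⟩ := exists_smul_eq_multisetWeight hb
  rw [← Submodule.smul_mem_iff _ ht, hπ]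
  exact multisetWeight_mem_Ma hG h (hπ ▸ smul_mem_Me hu t)

/-! ### From rational to real weights -/

/-- Every neighbourhood of a point of `ℝⁿ` contains finitely many rational points whose convex
hull contains that point; here they are the vertices of a box. -/
lemma exists_rational_box {ι : Type*} [Fintype ι] (r : ι → ℝ) {U : Set (ι → ℝ)}
    (hU : U ∈ nhds r) :
    r ∈ convexHull ℝ {t | t ∈ U ∧ ∃ q : ι → ℚ, ∀ k, t k = q k} := by
  obtain ⟨ε, hε, hεU⟩ := Metric.mem_nhds_iff.1 hU
  choose p hp using fun k => exists_rat_btwn (sub_lt_self (r k) hε)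
  choose q hq using fun k => exists_rat_btwn (lt_add_of_pos_right (r k) hε)
  have hr : r ∈ convexHull ℝ (Set.univ.pi fun k => ({(p k : ℝ), (q k : ℝ)} : Set ℝ)) := by
    refine mem_convexHull_pi fun k _ => ?_
    rw [convexHull_pair, segment_eq_Icc ((hp k).2.trans (hq k).1).le]
    exact ⟨(hp k).2.le, (hq k).1.le⟩
  refine convexHull_mono ?_ hr
  intro t ht
  refine ⟨hεU ?_, ?_⟩
  · rw [Metric.mem_ball, dist_pi_lt_iff hε]
    intro k
    rw [Real.dist_eq, abs_lt]
    rcases ht k trivial with h | h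
    · rw [h]; constructor <;> linarith [(hp k).1, (hp k).2]
    · rw [Set.mem_singleton_iff.1 h]; constructor <;> linarith [(hq k).1, (hq k).2]
  · have : ∀ k, ∃ c : ℚ, t k = c := fun k => by
      rcases ht k trivial with h | h
      · exact ⟨_, h⟩
      · exact ⟨_, Set.mem_singleton_iff.1 h⟩
    exact Classical.axiom_of_choice this

/-- Finitely many real numbers are rational linear forms in reals that are linearly independent
over `ℚ`. -/
lemma exists_rational_coordinates {α : Type*} (f : α → ℝ) (hf : (Set.range f).Finite) :
    ∃ (m : ℕ) (r : Fin m → ℝ) (c : α → Fin m → ℚ), LinearIndependent ℚ r ∧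
      (∀ a, f a = ∑ k, (c a k : ℝ) * r k) ∧ ∀ a, f a = 0 → c a = 0 := by
  let L := Submodule.span ℚ (Set.range f)
  have : FiniteDimensional ℚ L := FiniteDimensional.span_of_finite ℚ hf
  let e := Module.finBasis ℚ L
  have hmem : ∀ a, f a ∈ L := fun a => Submodule.subset_span ⟨a, rfl⟩
  refine ⟨_, fun k => (e k : ℝ), fun a => e.repr ⟨f a, hmem a⟩, ?_, fun a => ?_, fun a ha => ?_⟩
  · exact e.linearIndependent.map' L.subtype L.ker_subtype
  · have := congrArg (L.subtype) (e.sum_repr ⟨f a, hmem a⟩)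
    simp only [map_sum, map_smul, Submodule.subtype_apply, Rat.smul_def] at this
    exact this.symm
  · have : (⟨f a, hmem a⟩ : L) = 0 := Subtype.ext ha
    ext k
    simp [this]

/-- A homogeneous linear inequality with rational coefficients that holds at a point with rationally
independent coordinates holds near that point. -/
lemma eventually_nonneg_of_rational_coordinates {α ι : Type*} [Fintype ι] {r : ι → ℝ}
    (hr : LinearIndependent ℚ r) (c : α → ι → ℚ) (s : Finset α) (a : α → ℚ)
    (h : 0 ≤ ∑ x ∈ s, (a x : ℝ) * ∑ k, (c x k : ℝ) * r k) :
    ∀ᶠ t in nhds r, 0 ≤ ∑ x ∈ s, (a x : ℝ) * ∑ k, (c x k : ℝ) * t k := by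
  rcases h.eq_or_lt with h | h
  · have key : ∀ t : ι → ℝ, ∑ x ∈ s, (a x : ℝ) * ∑ k, (c x k : ℝ) * t k =
        ∑ k, ((∑ x ∈ s, a x * c x k : ℚ) : ℝ) * t k := fun t => by
      simp only [Finset.mul_sum, Rat.cast_sum, Finset.sum_mul, Rat.cast_mul]
      rw [Finset.sum_comm]
      simp only [mul_assoc]
    have hz := Fintype.linearIndependent_iff.1 hr (fun k => ∑ x ∈ s, a x * c x k) (by
      simp only [Rat.smul_def]
      rw [← key, ← h])
    refine Filter.Eventually.of_forall fun t => ?_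
    rw [key]
    simp [hz]
  · have hc : Continuous fun t : ι → ℝ => ∑ x ∈ s, (a x : ℝ) * ∑ k, (c x k : ℝ) * t k := by
      fun_prop
    exact (hc.continuousAt.eventually (lt_mem_nhds h)).mono fun _ => le_of_lt

/-- A vertex `w` closer than `u` to some member of a finite set `s` lies within a bounded distance
of `s`. -/
lemma exists_dist_bound (hG : G.Connected) (u : V) (s : Finset V) :
    ∃ N : ℕ, ∀ w, (∀ z ∈ s, G.dist u z ≤ G.dist w z) ∨ ∀ z ∈ s, G.dist w z ≤ N := by
  -- If d(w, y) < d(u, y), going from w to z through y and u gives d(w, z) < 2d(u, y) + d(u, z).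
  refine ⟨∑ y ∈ s, 2 * G.dist u y, fun w => or_iff_not_imp_left.2 fun h z hz => ?_⟩
  push Not at h
  obtain ⟨y, hy, hlt⟩ := h
  have h1 := hG.dist_triangle (u := w) (v := y) (w := z)
  have h2 := hG.dist_triangle (u := y) (v := u) (w := z)
  have hyu := G.dist_comm (u := y) (v := u)
  by_cases hyz : y = z
  · subst hyz
    have := Finset.single_le_sum (f := fun y => 2 * G.dist u y) (fun _ _ => Nat.zero_le _) hy
    omega
  · classical
    have := Finset.sum_le_sum_of_subset (f := fun y => 2 * G.dist u y)
      (Finset.insert_subset hy (Finset.singleton_subset_iff.2 hz))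
    rw [Finset.sum_pair hyz] at this
    omega

/-- Nonnegativity and the median inequalities at `u`, if they hold at a point with rationally
independent coordinates, hold near it: only finitely many of the inequalities are distinct and
nontrivial on weight functions supported on `s`. -/
lemma eventually_sum_dist_le {ι : Type*} [Fintype ι] (hG : G.Connected) (u : V) (s : Finset V)
    {r : ι → ℝ} (hr : LinearIndependent ℚ r) (c : V → ι → ℚ)
    (hnn : ∀ z ∈ s, 0 ≤ ∑ k, (c z k : ℝ) * r k)
    (hu : ∀ w, ∑ z ∈ s, (∑ k, (c z k : ℝ) * r k) * G.dist u z ≤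
      ∑ z ∈ s, (∑ k, (c z k : ℝ) * r k) * G.dist w z) :
    ∀ᶠ t in nhds r, (∀ z ∈ s, 0 ≤ ∑ k, (c z k : ℝ) * t k) ∧
      ∀ w, ∑ z ∈ s, (∑ k, (c z k : ℝ) * t k) * G.dist u z ≤
        ∑ z ∈ s, (∑ k, (c z k : ℝ) * t k) * G.dist w z := by
  classical
  have hnn' : ∀ᶠ t in nhds r, ∀ z ∈ s, 0 ≤ ∑ k, (c z k : ℝ) * t k := by
    rw [Filter.eventually_all_finset]
    intro z hz
    have := eventually_nonneg_of_rational_coordinates hr c {z} 1 (by simpa using hnn z hz)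
    simpa using this
  obtain ⟨N, hN⟩ := exists_dist_bound hG u s
  let T : Set V := {w | ∀ z ∈ s, G.dist w z ≤ N}
  let F : V → s → ℕ := fun w z => G.dist w z
  -- T may be infinite, but the inequality at w depends only on its distances to s, which are
  -- naturals bounded by N.
  have hfin : (F '' T).Finite := by
    refine (Set.finite_Iic (fun _ : s => N)).subset ?_
    rintro _ ⟨w, hw, rfl⟩ z
    exact hw z z.2
  have hT : ∀ᶠ t in nhds r, ∀ f ∈ F '' T, ∑ z ∈ s.attach, (∑ k, (c z k : ℝ) * t k) * G.dist u z ≤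
      ∑ z ∈ s.attach, (∑ k, (c z k : ℝ) * t k) * f z := by
    rw [Filter.eventually_all_finite hfin]
    rintro _ ⟨w, hw, rfl⟩
    have e : ∀ t : ι → ℝ, (∑ z ∈ s, (((G.dist w z : ℚ) - G.dist u z : ℚ) : ℝ) *
        ∑ k, (c z k : ℝ) * t k) =
        ∑ z ∈ s, (∑ k, (c z k : ℝ) * t k) * G.dist w z -
          ∑ z ∈ s, (∑ k, (c z k : ℝ) * t k) * G.dist u z := fun t => by
      rw [← Finset.sum_sub_distrib]
      refine Finset.sum_congr rfl fun z _ => ?_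
      push_cast
      ring
    have := eventually_nonneg_of_rational_coordinates hr c s
      (fun z => (G.dist w z : ℚ) - G.dist u z) (by rw [e]; exact sub_nonneg.2 (hu w))
    filter_upwards [this] with t ht
    rw [e, sub_nonneg] at ht
    rwa [← Finset.sum_attach s, ← Finset.sum_attach s] at ht
  filter_upwards [hnn', hT] with t h1 h2
  refine ⟨h1, fun w => ?_⟩
  rcases hN w with hw | hw
  -- No point of s is closer to w than to u, so nonnegative weights give the inequality termwise.
  · exact Finset.sum_le_sum fun z hz =>
      mul_le_mul_of_nonneg_left (Nat.cast_le.2 (hw z hz)) (h1 z hz)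
  · rw [← Finset.sum_attach s, ← Finset.sum_attach s fun z => _ * (G.dist w z : ℝ)]
    exact h2 _ ⟨w, hw, rfl⟩

lemma Me_subset_Ma (hG : G.Connected) (h : G.DoublePairingProperty) (u : V) :
    G.Me u ⊆ G.Ma u := by
  intro b hb
  rw [← mem_maSubmodule]
  have hrange : (Set.range fun v => (b v : ℝ)).Finite := by
    refine ((b.support.image fun v => (b v : ℝ)).finite_toSet.union
      (Set.finite_singleton 0)).subset ?_
    rintro _ ⟨v, rfl⟩
    by_cases hv : v ∈ b.support
    · exact Or.inl (Finset.mem_coe.2 (Finset.mem_image_of_mem _ hv))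
    · exact Or.inr (by simp [Finsupp.notMem_support_iff.1 hv])
  obtain ⟨m, r, c, hr, hbc, hc0⟩ := exists_rational_coordinates _ hrange
  have hev := eventually_sum_dist_le hG u b.support hr c (fun z _ => by
    rw [← hbc]; exact (b z).2) fun w => by
      simp only [← hbc]
      rw [← G.coe_weightedDist_eq_sum b u subset_rfl, ← G.coe_weightedDist_eq_sum b w subset_rfl]
      exact hb w
  -- The parameters t whose perturbed weight lies in Ma(u); it remains to see that r is one of them.
  let C : Set (Fin m → ℝ) :=
    {t | ∃ d ∈ G.maSubmodule u, ∀ v, (d v : ℝ) = ∑ k, (c v k : ℝ) * t k}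
  have hC : Convex ℝ C := by
    rintro t ⟨d, hd, hdt⟩ t' ⟨d', hd', hdt'⟩ x y hx hy -
    refine ⟨x.toNNReal • d + y.toNNReal • d',
      Submodule.add_mem _ (Submodule.smul_mem _ _ hd) (Submodule.smul_mem _ _ hd'), fun v => ?_⟩
    simp only [Finsupp.add_apply, Finsupp.smul_apply, smul_eq_mul, NNReal.coe_add, NNReal.coe_mul,
      Real.coe_toNNReal _ hx, Real.coe_toNNReal _ hy, hdt, hdt', Pi.add_apply, Pi.smul_apply, Finset.mul_sum]
    rw [← Finset.sum_add_distrib]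
    exact Finset.sum_congr rfl fun k _ => by ring
  obtain ⟨d, hd, hdb⟩ : r ∈ C := by
    refine convexHull_min ?_ hC (exists_rational_box r hev)
    rintro t ⟨⟨hnn, hmed⟩, q, hq⟩
    -- Zero values of b have zero coordinates, so the perturbation does not enlarge the support.
    have hsupp : ∀ v, v ∉ b.support → ∑ k, (c v k : ℝ) * t k = 0 := fun v hv => by
      rw [hc0 v (by simp [Finsupp.notMem_support_iff.1 hv])]
      simp
    have hnn' : ∀ v, 0 ≤ ∑ k, (c v k : ℝ) * t k := fun v => by
      by_cases hv : v ∈ b.support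
      · exact hnn v hv
      · exact (hsupp v hv).ge
    let d : V →₀ ℝ≥0 := Finsupp.onFinset b.support (fun v => ⟨_, hnn' v⟩) fun v hv => by
      by_contra hv'
      exact hv (NNReal.eq (hsupp v hv'))
    have hd : ∀ v, (d v : ℝ) = ∑ k, (c v k : ℝ) * t k := fun v => rfl
    refine ⟨d, mem_maSubmodule_of_rational hG h (fun v => ?_) fun w => ?_, hd⟩
    · have hdq : (d v : ℝ) = ((∑ k, c v k * q k : ℚ) : ℝ) := by
        rw [hd]
        simp [hq]
      have h0 : 0 ≤ ∑ k, c v k * q k := by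
        have := hnn' v
        rw [← hd, hdq] at this
        exact_mod_cast this
      refine ⟨⟨_, h0⟩, NNReal.eq ?_⟩
      rw [hdq]
      rfl
    · rw [← NNReal.coe_le_coe, G.coe_weightedDist_eq_sum d u Finsupp.support_onFinset_subset,
        G.coe_weightedDist_eq_sum d w Finsupp.support_onFinset_subset]
      exact hmed w
  have : d = b := by
    ext v
    rw [hdb, ← hbc]
  exact this ▸ hd

end SimpleGraph

end

theorem mainTheorem9 {V : Type*} (G : SimpleGraph V) (hG : G.Connected) :
    G.DoublePairingProperty ↔ ∀ u : V, G.Ma u = G.Me u := by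
  have := hG.nonempty
  exact ⟨fun h u => (SimpleGraph.Ma_subset_Me hG u).antisymm (SimpleGraph.Me_subset_Ma hG h u),
    fun h => SimpleGraph.doublePairingProperty_of_Me_subset_Ma fun u => (h u).ge⟩
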